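/- For $f:\mathbb{R}^d\to\mathbb{R}$ let $\partial f(x)=\{g:\ f(y)\ge f(x)+\langle g,y-x\rangle\ \forall y\in\mathbb{R}^d\}$ (Euclidean inner product and norm). For $M\ge 0$ let $\mathcal{C}_M(\mathbb{R}^d)$ be the class of closed proper convex functions $f:\mathbb{R}^d\to\mathbb{R}$ such that $\|g\|\le M$ for all $x\in\mathbb{R}^d$ and all $g\in\partial f(x)$. For $R_x\ge 0$, a pair $(f,x_0)$ is a $(\mathcal{C}_M(\mathbb{R}^d),R_x)$-input if $f\in\mathcal{C}_M(\mathbb{R}^d)$, $x_0\in\mathbb{R}^d$, and $\|x_0-x_*\|\le R_x$ for some minimizer $x_*$ of $f$; write $f_*=\min f$. The greedy first-order method (GFOM), given $f$, $x_0$ and $N\in\mathbb{N}=\{0,1,2,\dots\}$, chooses some $f'(x_0)\in\partial f(x_0)$ and then, for $i=1,\dots,N$, takes some $$x_i\in\operatorname{argmin}\{f(x):\ x\in x_0+\mathrm{span}\{f'(x_0),\dots,f'(x_{i-1})\}\}$$ and chooses some $f'(x_i)\in\partial f(x_i)$ with $\langle f'(x_i),f'(x_j)\rangle=0$ for all $0\le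 j<i$. Its output is $x_N$; it yields no output if a required minimum is not attained. Since the choices are not unique, an input may have several possible outputs. **Corollary.** Let $d,N\in\mathbb{N}$ and $M,R_x\ge 0$. 1. For every $(\mathcal{C}_M(\mathbb{R}^d),R_x)$-input $(f,x_0)$, every output $x_N$ of GFOM after $N$ steps satisfies $$f(x_N)-f_*\le\frac{MR_x}{\sqrt{N+1}}.$$ Furthermore, this bound is tight when $d\ge 2N+2$: for every $\varepsilon>0$ there is a $(\mathcal{C}_M(\mathbb{R}^d),R_x)$-input $(\hat f,\hat x_0)$ on which GFOM yields an output after $N$ steps, and every such output $\hat x_N$ satisfies $$\hat f(\hat x_N)-\hat f_*\ge\frac{MR_x}{\sqrt{N+1}}-\varepsilon.$$ 2. Let $(f,x_0)$ be a $(\mathcal{C}_M(\mathbb{R}^d),R_x)$-input, let $x_1,\dots,x_N\in\mathbb{R}^d$, and let $f'(x_i)\in\partial f(x_i)$, $i=0,\dots,N$, be any choice of subgradients such that $$\left\langle f'(x_i),\ x_i-\left[\frac{i}{i+1}x_{i-1}+\frac{1}{i+1}x_0-\frac{1}{i+1}\,\frac{R_x}{M\sqrt{N+1}}\sum_{j=0}^{i-1}f'(x_j)\right]\right\rangle=0,\qquad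 i=1,\dots,N.$$ Then $$f(x_N)-f_*\le\frac{MR_x}{\sqrt{N+1}}.$$ (If $M=0$, all subgradients vanish and the condition is understood to hold trivially.) -/

import Mathlib

namespace GreedyFOM

/-- The subdifferential `∂f(x)` of a function `f : ℝ^d → ℝ`. -/
def subdifferential {d : ℕ} (f : EuclideanSpace ℝ (Fin d) → ℝ)
    (x : EuclideanSpace ℝ (Fin d)) : Set (EuclideanSpace ℝ (Fin d)) :=
  {g | ∀ y, f x + inner ℝ g (y - x) ≤ f y}

/-- The class `C_M(ℝ^d)` of closed proper convex functions all of whose subgradients have norm at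
most `M`. (The functions are finite everywhere, so they are automatically proper.) -/
def boundedSubgradientClass (d : ℕ) (M : ℝ) : Set (EuclideanSpace ℝ (Fin d) → ℝ) :=
  {f | LowerSemicontinuous f ∧ ConvexOn ℝ Set.univ f ∧
    ∀ x, ∀ g ∈ subdifferential f x, ‖g‖ ≤ M}

/-- `(f, x₀)` is an `(F, R)`-input: `f ∈ F` has a minimizer at distance at most `R` from `x₀`. -/
def IsInput {d : ℕ} (F : Set (EuclideanSpace ℝ (Fin d) → ℝ)) (R : ℝ)
    (f : EuclideanSpace ℝ (Fin d) → ℝ) (x₀ : EuclideanSpace ℝ (Fin d)) : Prop :=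
  f ∈ F ∧ ∃ xs, IsMinOn f Set.univ xs ∧ ‖x₀ - xs‖ ≤ R

/-- The optimal value `f_*`. It is used only for functions that attain their minimum. -/
noncomputable def optVal {d : ℕ} (f : EuclideanSpace ℝ (Fin d) → ℝ) : ℝ := ⨅ x, f x

/-- `x 0, …, x N` and `g 0, …, g N` are the iterates and the chosen subgradients of an execution
of `N` steps of the greedy first-order method on `(f, x₀)`. Values beyond index `N` are
irrelevant. -/
structure IsGFOMRun {d : ℕ} (f : EuclideanSpace ℝ (Fin d) → ℝ) (x₀ : EuclideanSpace ℝ (Fin d))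
    (N : ℕ) (x g : ℕ → EuclideanSpace ℝ (Fin d)) : Prop where
  init : x 0 = x₀
  subgrad : ∀ i ≤ N, g i ∈ subdifferential f (x i)
  mem : ∀ i, 1 ≤ i → i ≤ N →
    x i ∈ AffineSubspace.mk' x₀ (Submodule.span ℝ (g '' Set.Iio i))
  min : ∀ i, 1 ≤ i → i ≤ N →
    IsMinOn f (AffineSubspace.mk' x₀ (Submodule.span ℝ (g '' Set.Iio i)) : Set _) (x i)
  orth : ∀ i, 1 ≤ i → i ≤ N → ∀ j < i, inner ℝ (g i) (g j) = 0

/-- `y` is a possible output `GFOM_N(f, x₀)` (the method is not deterministic, and it need not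
have an output). -/
def IsGFOMOutput {d : ℕ} (f : EuclideanSpace ℝ (Fin d) → ℝ) (x₀ : EuclideanSpace ℝ (Fin d))
    (N : ℕ) (y : EuclideanSpace ℝ (Fin d)) : Prop :=
  ∃ x g, IsGFOMRun f x₀ N x g ∧ x N = y

end GreedyFOM

namespace GreedyFOM

open Finset

variable {d : ℕ}

local notation "E" d => EuclideanSpace ℝ (Fin d)

/-! Upper bound: adding the subgradient inequalities at `x i`, tested at the minimizer and at `x (i
- 1)` with weights 1 and `i`, telescopes (`telescoped_subgradient_inequality`). With `S` the sum of
all subgradients, the cross terms are governed by `‖S‖ ^ 2`, and the step size completes a square in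
`‖S‖`. A greedy run satisfies the same scheme because each new subgradient is orthogonal to the span
explored so far.

Lower bound: in a maximum of scaled coordinates, the offsets `δ * j` break ties so that each
subgradient reveals at most one new coordinate. After `N` steps coordinate `N` is still zero, which
keeps the value above `-(δ * N)`, while the minimum is `-(M * R / √(N + 1))`. -/

lemma optVal_eq_of_isMinOn {f : (E d) → ℝ} {xs : E d} (h : IsMinOn f Set.univ xs) :
    optVal f = f xs := by
  have hle : ∀ y, f xs ≤ f y := fun y => h (Set.mem_univ y)
  exact le_antisymm (ciInf_le ⟨f xs, by rintro _ ⟨y, rfl⟩; exact hle y⟩ xs) (le_ciInf hle)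

/-! ### Upper bound. -/

/-- Twice the sum of the off-diagonal inner products is the square of the norm of the sum minus the
sum of the squares of the norms. -/
lemma two_mul_sum_inner_sum_range {V : Type*} [NormedAddCommGroup V] [InnerProductSpace ℝ V]
    (g : ℕ → V) (n : ℕ) :
    2 * ∑ i ∈ range n, (inner ℝ (g i) (∑ j ∈ range i, g j) : ℝ) =
      ‖∑ i ∈ range n, g i‖ ^ 2 - ∑ i ∈ range n, ‖g i‖ ^ 2 := by
  induction n with
  | zero => simp
  | succ n ih =>
    rw [sum_range_succ, mul_add, ih, sum_range_succ _ n, sum_range_succ _ n, norm_add_sq_real,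
      real_inner_comm]
    ring

/-- The telescoped sum of the weighted subgradient inequalities of a subgradient scheme with
step-size parameter `h`. -/
lemma telescoped_subgradient_inequality {f : (E d) → ℝ} {x₀ xs : E d} {x g : ℕ → E d} {h : ℝ}
    (hx : x 0 = x₀) (n : ℕ) (hg : ∀ i ≤ n, g i ∈ subdifferential f (x i))
    (hs : ∀ i, 1 ≤ i → i ≤ n →
      inner ℝ (g i) (x i - (((i : ℝ) / ((i : ℝ) + 1)) • x (i - 1) + (1 / ((i : ℝ) + 1)) • x₀
        - (1 / ((i : ℝ) + 1) * h) • ∑ j ∈ range i, g j)) = 0) :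
    (n + 1) * (f (x n) - f xs) ≤ inner ℝ (∑ i ∈ range (n + 1), g i) (x₀ - xs)
      - h * ∑ i ∈ range (n + 1), (inner ℝ (g i) (∑ j ∈ range i, g j) : ℝ) := by
  induction n with
  | zero =>
    have := hg 0 le_rfl xs
    rw [hx] at this
    have e : (inner ℝ (g 0) (xs - x₀) : ℝ) = -inner ℝ (g 0) (x₀ - xs) := by
      rw [← inner_neg_right, neg_sub]
    simp [hx]
    linarith
  | succ n ih =>
    have ih := ih (fun i hi => hg i (by omega)) (fun i h1 hi => hs i h1 (by omega))
    have h1 := hg (n + 1) le_rfl xs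
    have h2 := hg (n + 1) le_rfl (x n)
    have h3 := hs (n + 1) (by omega) le_rfl
    rw [sum_range_succ, sum_range_succ _ (n + 1), inner_add_left, mul_add]
    simp only [Nat.add_sub_cancel, inner_sub_right, inner_add_right, inner_smul_right] at h1 h2 h3 ⊢
    push_cast at h3 ⊢
    have hp : (n : ℝ) + 1 + 1 ≠ 0 := by positivity
    field_simp at h3
    have hn : (0 : ℝ) ≤ n + 1 := by positivity
    -- The weight `n + 1` on the test at `x n` matches the coefficient in the induction hypothesis,
    -- so `f (x n)` cancels.
    have h4 := mul_le_mul_of_nonneg_left h2 hn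
    rw [inner_sub_right] at ih
    nlinarith

lemma sub_optVal_le_of_scheme {N : ℕ} {M R : ℝ} (hM : 0 ≤ M) (hR : 0 ≤ R)
    {f : (E d) → ℝ} {x₀ : E d} (hf : IsInput (boundedSubgradientClass d M) R f x₀)
    {x g : ℕ → E d} (hx : x 0 = x₀) (hg : ∀ i ≤ N, g i ∈ subdifferential f (x i))
    (hs : ∀ i, 1 ≤ i → i ≤ N →
      inner ℝ (g i) (x i - (((i : ℝ) / ((i : ℝ) + 1)) • x (i - 1) + (1 / ((i : ℝ) + 1)) • x₀
        - (1 / ((i : ℝ) + 1) * (R / (M * √((N : ℝ) + 1)))) • ∑ j ∈ range i, g j)) = 0) :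
    f (x N) - optVal f ≤ M * R / √((N : ℝ) + 1) := by
  obtain ⟨⟨-, -, hb⟩, xs, hmin, hxs⟩ := hf
  rw [optVal_eq_of_isMinOn hmin]
  have hbd : ∀ i ≤ N, ‖g i‖ ≤ M := fun i hi => hb _ _ (hg i hi)
  -- For `M = 0` the step size is a division by zero; the last subgradient vanishes, so `x N` is
  -- already optimal.
  rcases hM.eq_or_lt with rfl | hM
  · have h0 : g N = 0 := norm_le_zero_iff.1 (hbd N le_rfl)
    have := hg N le_rfl xs
    simp only [h0, inner_zero_left, add_zero] at this
    simpa using this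
  have hT := telescoped_subgradient_inequality (xs := xs) hx N hg hs
  set s : ℝ := √((N : ℝ) + 1) with hsdef
  have hs0 : 0 < s := Real.sqrt_pos.2 (by positivity)
  have hss : s ^ 2 = N + 1 := Real.sq_sqrt (by positivity)
  have hsum := two_mul_sum_inner_sum_range g (N + 1)
  set S := ∑ i ∈ range (N + 1), g i
  have hsq : ∑ i ∈ range (N + 1), ‖g i‖ ^ 2 ≤ s ^ 2 * M ^ 2 := by
    calc ∑ i ∈ range (N + 1), ‖g i‖ ^ 2 ≤ ∑ _i ∈ range (N + 1), M ^ 2 :=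
          sum_le_sum fun i hi => pow_le_pow_left₀ (norm_nonneg _)
            (hbd i (Nat.lt_succ_iff.1 (mem_range.1 hi))) 2
      _ = s ^ 2 * M ^ 2 := by simp [hss]
  have hin : (inner ℝ S (x₀ - xs) : ℝ) ≤ ‖S‖ * R :=
    (real_inner_le_norm _ _).trans (mul_le_mul_of_nonneg_left hxs (norm_nonneg _))
  set P := ∑ i ∈ range (N + 1), (inner ℝ (g i) (∑ j ∈ range i, g j) : ℝ)
  have hP : R / (M * s) * (‖S‖ ^ 2 - s ^ 2 * M ^ 2) ≤ R / (M * s) * (2 * P) :=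
    mul_le_mul_of_nonneg_left (by linarith) (by positivity)
  -- The step size is chosen so that `‖S‖ = M * s` is the worst case.
  have hq : 0 ≤ R / (M * s) * (‖S‖ - M * s) ^ 2 := by positivity
  have e : R / (M * s) * (M * s) = R := div_mul_cancel₀ _ (by positivity)
  rw [← hss] at hT
  rw [le_div_iff₀ hs0]
  have key : s ^ 2 * (f (x N) - f xs) ≤ s * (M * R) := by
    set r := R / (M * s)
    rw [← e] at hin ⊢
    nlinarith
  have : s * (s * (f (x N) - f xs)) ≤ s * (M * R) := by linarith
  linarith [le_of_mul_le_mul_left this hs0]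

/-- The two averaging weights sum to 1, so the second argument is a combination of `x i - x₀`, `x (i
- 1) - x₀` and earlier subgradients, all orthogonal to `g i`. -/
lemma IsGFOMRun.inner_sub_eq_zero {f : (E d) → ℝ} {x₀ : E d} {N : ℕ} {x g : ℕ → E d}
    (h : IsGFOMRun f x₀ N x g) (t : ℝ) {i : ℕ} (h1 : 1 ≤ i) (hi : i ≤ N) :
    inner ℝ (g i) (x i - (((i : ℝ) / ((i : ℝ) + 1)) • x (i - 1) + (1 / ((i : ℝ) + 1)) • x₀
      - t • ∑ j ∈ range i, g j)) = 0 := by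
  set W := Submodule.span ℝ (g '' Set.Iio i)
  have hmem : ∀ k ≤ i, x k - x₀ ∈ W := by
    intro k hk
    rcases Nat.eq_zero_or_pos k with rfl | hk0
    · simp [h.init]
    · have := h.mem k hk0 (hk.trans hi)
      rw [AffineSubspace.mem_mk', vsub_eq_sub] at this
      exact Submodule.span_mono (Set.image_mono (Set.Iio_subset_Iio hk)) this
  have horth : ∀ v ∈ W, (inner ℝ (g i) v : ℝ) = 0 := by
    intro v hv
    induction hv using Submodule.span_induction with
    | mem v hv => obtain ⟨j, hj, rfl⟩ := hv; exact h.orth i h1 hi j hj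
    | zero => simp
    | add u v _ _ hu hv => simp [inner_add_right, hu, hv]
    | smul a u _ hu => simp [inner_smul_right, hu]
  apply horth
  have hsum : ∑ j ∈ range i, g j ∈ W :=
    W.sum_mem fun j hj => Submodule.subset_span ⟨j, by simpa using hj, rfl⟩
  have e : x i - (((i : ℝ) / ((i : ℝ) + 1)) • x (i - 1) + (1 / ((i : ℝ) + 1)) • x₀
      - t • ∑ j ∈ range i, g j) = (x i - x₀) - ((i : ℝ) / ((i : ℝ) + 1)) • (x (i - 1) - x₀)
      + t • ∑ j ∈ range i, g j := by
    have hp : (i : ℝ) + 1 ≠ 0 := by positivity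
    have : (1 / ((i : ℝ) + 1)) = 1 - (i : ℝ) / ((i : ℝ) + 1) := by field_simp; ring
    rw [this]
    module
  rw [e]
  exact W.add_mem (W.sub_mem (hmem i le_rfl) (W.smul_mem _ (hmem _ (Nat.sub_le _ _))))
    (W.smul_mem _ hsum)

/-! ### Lower bound: the hard function. -/

/-- The hard instance: the maximum of the constant `c` and of the scaled coordinates
`M * x j - δ * j`, `j ≤ N`. -/
noncomputable def hardFunction (d N : ℕ) (M c δ : ℝ) (x : E d) : ℝ :=
  (univ.filter fun j : Fin d => (j : ℕ) ≤ N).fold max c fun j => M * x j - δ * (j : ℕ)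

section HardFunction

variable {N : ℕ} {M c δ : ℝ}

lemma hardFunction_le_iff {x : E d} {a : ℝ} :
    hardFunction d N M c δ x ≤ a ↔
      c ≤ a ∧ ∀ j : Fin d, (j : ℕ) ≤ N → M * x j - δ * (j : ℕ) ≤ a := by
  simp [hardFunction, Finset.fold_max_le]

lemma le_hardFunction (x : E d) : c ≤ hardFunction d N M c δ x :=
  (hardFunction_le_iff.1 le_rfl).1

lemma coord_le_hardFunction (x : E d) {j : Fin d} (hj : (j : ℕ) ≤ N) :
    M * x j - δ * (j : ℕ) ≤ hardFunction d N M c δ x :=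
  (hardFunction_le_iff.1 le_rfl).2 j hj

lemma hardFunction_le_add (hM : 0 ≤ M) (x y : E d) :
    hardFunction d N M c δ x ≤ hardFunction d N M c δ y + M * ‖x - y‖ := by
  refine hardFunction_le_iff.2 ⟨?_, fun j hj => ?_⟩
  · have : 0 ≤ M * ‖x - y‖ := by positivity
    linarith [le_hardFunction (N := N) (M := M) (c := c) (δ := δ) y]
  · have h1 := coord_le_hardFunction (M := M) (c := c) (δ := δ) y hj
    have h2 : x j - y j ≤ ‖x - y‖ :=
      (le_abs_self _).trans (by simpa using PiLp.norm_apply_le (x - y) j)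
    linarith [mul_le_mul_of_nonneg_left h2 hM]

lemma hardFunction_mem_boundedSubgradientClass (hM : 0 ≤ M) :
    hardFunction d N M c δ ∈ boundedSubgradientClass d M := by
  refine ⟨?_, ⟨convex_univ, ?_⟩, ?_⟩
  · refine (LipschitzWith.of_le_add_mul ⟨M, hM⟩ fun x y => ?_).continuous.lowerSemicontinuous
    rw [dist_eq_norm]
    exact hardFunction_le_add hM x y
  · intro x _ y _ a b ha hb hab
    refine hardFunction_le_iff.2 ⟨?_, fun j hj => ?_⟩
    · have h1 := mul_le_mul_of_nonneg_left
        (le_hardFunction (N := N) (M := M) (c := c) (δ := δ) x) ha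
      have h2 := mul_le_mul_of_nonneg_left
        (le_hardFunction (N := N) (M := M) (c := c) (δ := δ) y) hb
      have e : c = a * c + b * c := by rw [← add_mul, hab, one_mul]
      simp only [smul_eq_mul]
      linarith
    · have h1 := mul_le_mul_of_nonneg_left
        (coord_le_hardFunction (M := M) (c := c) (δ := δ) x hj) ha
      have h2 := mul_le_mul_of_nonneg_left
        (coord_le_hardFunction (M := M) (c := c) (δ := δ) y hj) hb
      have e : δ * (j : ℕ) = a * (δ * (j : ℕ)) + b * (δ * (j : ℕ)) := by
        rw [← add_mul, hab, one_mul]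
      simp only [PiLp.add_apply, PiLp.smul_apply, smul_eq_mul]
      linarith
  · intro x g hg
    have h1 := hg (x + g)
    have h2 := hardFunction_le_add (N := N) (c := c) (δ := δ) hM (x + g) x
    rw [add_sub_cancel_left] at h1 h2
    rw [real_inner_self_eq_norm_sq] at h1
    rcases (norm_nonneg g).eq_or_lt with h0 | h0
    · rwa [← h0]
    · exact le_of_mul_le_mul_right (by linarith) h0

/-- A lower bound for the hard function at points with a vanishing coordinate. -/
lemma neg_le_hardFunction (hd : N < d) {x : E d} {i : ℕ} (hi : i ≤ N)
    (hx : ∀ j : Fin d, i ≤ j → x j = 0) : -(δ * i) ≤ hardFunction d N M c δ x := by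
  have := coord_le_hardFunction (M := M) (c := c) (δ := δ) x (j := ⟨i, by omega⟩) hi
  simpa [hx ⟨i, by omega⟩ le_rfl] using this

/-- Subgradients of the hard function discover at most one new coordinate. -/
lemma subgradient_hardFunction_apply_eq_zero (hd : N < d) (hM : 0 < M) (hδ : 0 < δ) {x g : E d}
    {i : ℕ} (hi : i ≤ N) (hx : ∀ j : Fin d, i ≤ j → x j = 0)
    (hg : g ∈ subdifferential (hardFunction d N M c δ) x) {k : Fin d} (hk : i + 1 ≤ k) :
    g k = 0 := by
  -- Moving coordinate `k` by `t` raises its piece to at most `δ - δ * k ≤ -(δ * i)`, so the maximum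
  -- does not grow. Both signs of `t` then force `g k = 0`.
  have key : ∀ t : ℝ, M * t ≤ δ → t * g k ≤ 0 := by
    intro t ht
    have h1 := hg (x + EuclideanSpace.single k t)
    have h2 : hardFunction d N M c δ (x + EuclideanSpace.single k t) ≤
        hardFunction d N M c δ x := by
      refine hardFunction_le_iff.2 ⟨le_hardFunction x, fun j hj => ?_⟩
      by_cases hjk : j = k
      · subst hjk
        have h3 := neg_le_hardFunction (M := M) (c := c) (δ := δ) hd hi hx
        have h4 : δ * (i + 1) ≤ δ * (j : ℕ) :=
          mul_le_mul_of_nonneg_left (by exact_mod_cast hk) hδ.le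
        simp [hx j (by omega)]
        linarith
      · simpa [hjk] using coord_le_hardFunction (M := M) (c := c) (δ := δ) x hj
    rw [add_sub_cancel_left, EuclideanSpace.inner_single_right] at h1
    simp only [conj_trivial] at h1
    linarith
  have hp : 0 < δ / M := div_pos hδ hM
  have h1 := key (δ / M) (mul_div_cancel₀ _ hM.ne').le
  have h2 := key (-(δ / M)) (by rw [mul_neg, mul_div_cancel₀ _ hM.ne']; linarith)
  nlinarith

lemma IsGFOMRun.apply_eq_zero (hd : N < d) (hM : 0 < M) (hδ : 0 < δ) {x g : ℕ → E d}
    (h : IsGFOMRun (hardFunction d N M c δ) 0 N x g) (i : ℕ) (hi : i ≤ N) :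
    ∀ j : Fin d, i ≤ j → x i j = 0 := by
  induction i using Nat.strong_induction_on with
  | _ i ih =>
    intro j hj
    rcases Nat.eq_zero_or_pos i with rfl | hi0
    · simp [h.init]
    have hm := h.mem i hi0 hi
    rw [AffineSubspace.mem_mk', vsub_eq_sub, sub_zero] at hm
    generalize x i = w at hm
    induction hm using Submodule.span_induction with
    | mem v hv =>
      obtain ⟨l, hl, rfl⟩ := hv
      have hl : l < i := hl
      exact subgradient_hardFunction_apply_eq_zero hd hM hδ (hl.le.trans hi)
        (ih l hl (hl.le.trans hi)) (h.subgrad l (hl.le.trans hi)) (by omega)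
    | zero => simp
    | add u v _ _ hu hv => simp [hu, hv]
    | smul a u _ hu => simp [hu]

/-! ### An explicit run and the minimizer. -/

/-- The vector whose first `n` coordinates are `a` and whose other coordinates are `0`. -/
noncomputable def initialVec (d : ℕ) (a : ℝ) (n : ℕ) : E d :=
  WithLp.toLp 2 fun j : Fin d => if (j : ℕ) < n then a else 0

/-- A scaled coordinate vector, which is `0` for indices out of range. -/
noncomputable def coordVec (d : ℕ) (a : ℝ) (n : ℕ) : E d :=
  WithLp.toLp 2 fun j : Fin d => if (j : ℕ) = n then a else 0

lemma initialVec_mem_span (hM : M ≠ 0) (a : ℝ) (i : ℕ) :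
    initialVec d a i ∈ Submodule.span ℝ (coordVec d M '' Set.Iio i) := by
  have e : initialVec d a i = ∑ j ∈ range i, (a / M) • coordVec d M j := by
    ext k
    simp [initialVec, coordVec, WithLp.ofLp_sum, hM]
  rw [e]
  exact Submodule.sum_mem _ fun j hj =>
    Submodule.smul_mem _ _ (Submodule.subset_span ⟨j, by simpa using hj, rfl⟩)

lemma inner_coordVec (hd : N < d) {i : ℕ} (hi : i ≤ N) (y : E d) :
    (inner ℝ (coordVec d M i) y : ℝ) = M * y ⟨i, by omega⟩ := by
  have e : coordVec d M i = EuclideanSpace.single (⟨i, by omega⟩ : Fin d) M := by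
    ext k
    simp [coordVec, Fin.ext_iff]
  rw [e, EuclideanSpace.inner_single_left]
  simp

lemma hardFunction_initialVec (hd : N < d) (hδ : 0 ≤ δ) {a : ℝ} (hc : M * a = c) (hcδ : c ≤ -(δ * N))
    {i : ℕ} (hi : i ≤ N) :
    hardFunction d N M c δ (initialVec d a i) = -(δ * i) := by
  have hiN : δ * i ≤ δ * N := mul_le_mul_of_nonneg_left (by exact_mod_cast hi) hδ
  refine le_antisymm (hardFunction_le_iff.2 ⟨by linarith, fun j hj => ?_⟩)
    (neg_le_hardFunction hd hi fun j hj => by simp [initialVec, hj])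
  by_cases hji : (j : ℕ) < i
  · have : 0 ≤ δ * (j : ℕ) := by positivity
    simp [initialVec, hji]
    linarith
  · have : δ * i ≤ δ * (j : ℕ) := mul_le_mul_of_nonneg_left (by exact_mod_cast not_lt.1 hji) hδ
    simp [initialVec, hji]
    linarith

/-- Guarantees that an output exists. At step `i` piece `i` attains the maximum, so `M` times the
`i`-th basis vector is a subgradient. -/
lemma isGFOMRun_hardFunction (hd : N < d) (hM : 0 < M) (hδ : 0 ≤ δ) {a : ℝ} (hc : M * a = c)
    (hcδ : c ≤ -(δ * N)) :
    IsGFOMRun (hardFunction d N M c δ) 0 N (initialVec d a) (coordVec d M) where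
  init := by ext; simp [initialVec]
  subgrad := by
    intro i hi y
    rw [hardFunction_initialVec hd hδ hc hcδ hi, inner_sub_right, inner_coordVec hd hi,
      inner_coordVec hd hi]
    have := coord_le_hardFunction (M := M) (c := c) (δ := δ) y (j := ⟨i, by omega⟩) hi
    simp only [initialVec, lt_irrefl, if_false]
    linarith
  mem := by
    intro i _ _
    rw [AffineSubspace.mem_mk', vsub_eq_sub, sub_zero]
    exact initialVec_mem_span hM.ne' a i
  min := by
    intro i _ hi y hy
    rw [SetLike.mem_coe, AffineSubspace.mem_mk', vsub_eq_sub, sub_zero] at hy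
    rw [Set.mem_ofPred_eq, hardFunction_initialVec hd hδ hc hcδ hi]
    refine neg_le_hardFunction hd hi fun j hj => ?_
    induction hy using Submodule.span_induction with
    | mem v hv =>
      obtain ⟨l, hl, rfl⟩ := hv
      have hl : l < i := hl
      have : (j : ℕ) ≠ l := by omega
      simp [coordVec, this]
    | zero => simp
    | add u v _ _ hu hv => simp [hu, hv]
    | smul a u _ hu => simp [hu]
  orth := by
    intro i _ hi j hj
    rw [inner_coordVec hd hi]
    simp [coordVec, hj.ne']

lemma isMinOn_hardFunction (hδ : 0 ≤ δ) {a : ℝ} (hc : M * a = c) :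
    IsMinOn (hardFunction d N M c δ) Set.univ (initialVec d a (N + 1)) := by
  intro y _
  refine (hardFunction_le_iff.2 ⟨le_rfl, fun j hj => ?_⟩).trans (le_hardFunction y)
  have : 0 ≤ δ * (j : ℕ) := by positivity
  simp [initialVec, hj]
  linarith

lemma hardFunction_initialVec_succ (hδ : 0 ≤ δ) {a : ℝ} (hc : M * a = c) :
    hardFunction d N M c δ (initialVec d a (N + 1)) = c := by
  refine le_antisymm (hardFunction_le_iff.2 ⟨le_rfl, fun j hj => ?_⟩) (le_hardFunction _)
  have : 0 ≤ δ * (j : ℕ) := by positivity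
  simp [initialVec, hj]
  linarith

lemma norm_initialVec_sq (hd : N < d) (a : ℝ) :
    ‖initialVec d a (N + 1)‖ ^ 2 = (N + 1) * a ^ 2 := by
  rw [EuclideanSpace.norm_sq_eq]
  have : ∀ j : Fin d, ‖initialVec d a (N + 1) j‖ ^ 2 = if (j : ℕ) < N + 1 then a ^ 2 else 0 := by
    intro j
    simp only [initialVec]
    split_ifs <;> simp
  rw [sum_congr rfl fun j _ => this j, Fin.sum_univ_eq_sum_range
    (fun j => if j < N + 1 then a ^ 2 else 0) d, ← sum_filter,
    show (range d).filter (· < N + 1) = range (N + 1) by ext; simp; omega]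
  simp

end HardFunction

lemma exists_hard_input {N : ℕ} {M R : ℝ} (hM : 0 ≤ M) (hR : 0 ≤ R) (hd : N < d) {ε : ℝ}
    (hε : 0 < ε) :
    ∃ (f : (E d) → ℝ) (x₀ : E d), IsInput (boundedSubgradientClass d M) R f x₀ ∧
      (∃ y, IsGFOMOutput f x₀ N y) ∧
      ∀ y, IsGFOMOutput f x₀ N y → M * R / √((N : ℝ) + 1) - ε ≤ f y - optVal f := by
  have hs0 : 0 < √((N : ℝ) + 1) := Real.sqrt_pos.2 (by positivity)
  have hss : √((N : ℝ) + 1) ^ 2 = N + 1 := Real.sq_sqrt (by positivity)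
  set s := √((N : ℝ) + 1)
  rcases (mul_nonneg hM hR).eq_or_lt with h0 | h0
  · have hmin : IsMinOn (fun _ : E d => (0 : ℝ)) Set.univ 0 := fun _ _ => le_refl (0 : ℝ)
    refine ⟨fun _ => 0, 0, ⟨⟨continuous_const.lowerSemicontinuous,
      convexOn_const 0 convex_univ, fun x g hg => ?_⟩, 0, hmin, by simpa using hR⟩,
      ⟨0, fun _ => 0, fun _ => 0, ?_, rfl⟩, fun y _ => ?_⟩
    · have := hg (x + g)
      rw [add_sub_cancel_left, real_inner_self_eq_norm_sq, zero_add] at this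
      nlinarith [norm_nonneg g]
    · refine ⟨rfl, fun _ _ y => by simp, fun i _ _ => AffineSubspace.self_mem_mk' _ _,
        fun i _ _ _ _ => le_refl (0 : ℝ), fun i _ _ j _ => by simp⟩
    · rw [optVal_eq_of_isMinOn hmin, ← h0]
      simp
      exact hε.le
  have hM' : 0 < M := hM.lt_of_ne (by rintro rfl; simp at h0)
  set a := -(R / s) with ha
  have hcpos : 0 < M * R / s := div_pos h0 hs0
  have hc : M * a = -(M * R / s) := by rw [ha]; ring
  -- The bound by `ε` limits the loss in the gap; the bound by `M * R / s` keeps the floor `c` below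
  -- `-(δ * N)`, as the explicit run needs.
  set δ := min ε (M * R / s) / (N + 1)
  have hδ : 0 < δ := div_pos (lt_min hε hcpos) (by positivity)
  have hδN : δ * N ≤ min ε (M * R / s) := by
    have : δ * (N + 1) = min ε (M * R / s) := div_mul_cancel₀ _ (by positivity)
    linarith
  have hmin := isMinOn_hardFunction (d := d) (N := N) hδ.le hc
  refine ⟨hardFunction d N M (-(M * R / s)) δ, 0,
    ⟨hardFunction_mem_boundedSubgradientClass hM, _, hmin, ?_⟩,
    ⟨_, _, _, isGFOMRun_hardFunction hd hM' hδ.le hc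
      (by linarith [min_le_right ε (M * R / s)]), rfl⟩, ?_⟩
  · rw [zero_sub, norm_neg]
    refine le_of_sq_le_sq ?_ hR
    rw [norm_initialVec_sq hd, ← hss, ha, neg_sq, div_pow, mul_div_cancel₀ _ (by positivity)]
  · rintro _ ⟨x, g, hrun, rfl⟩
    rw [optVal_eq_of_isMinOn hmin, hardFunction_initialVec_succ hδ.le hc]
    have := neg_le_hardFunction (M := M) (c := -(M * R / s)) (δ := δ) hd le_rfl
      (hrun.apply_eq_zero hd hM' hδ N le_rfl)
    linarith [min_le_left ε (M * R / s)]

end GreedyFOM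

theorem mainTheorem4 (d N : ℕ) (M R : ℝ) (hM : 0 ≤ M) (hR : 0 ≤ R) :
    (∀ (f : EuclideanSpace ℝ (Fin d) → ℝ) (x₀ : EuclideanSpace ℝ (Fin d)),
      GreedyFOM.IsInput (GreedyFOM.boundedSubgradientClass d M) R f x₀ →
      ∀ y, GreedyFOM.IsGFOMOutput f x₀ N y →
        f y - GreedyFOM.optVal f ≤ M * R / √((N : ℝ) + 1)) ∧
    (2 * N + 2 ≤ d → ∀ ε : ℝ, 0 < ε →
      ∃ (f : EuclideanSpace ℝ (Fin d) → ℝ) (x₀ : EuclideanSpace ℝ (Fin d)),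
        GreedyFOM.IsInput (GreedyFOM.boundedSubgradientClass d M) R f x₀ ∧
        (∃ y, GreedyFOM.IsGFOMOutput f x₀ N y) ∧
        ∀ y, GreedyFOM.IsGFOMOutput f x₀ N y →
          M * R / √((N : ℝ) + 1) - ε ≤ f y - GreedyFOM.optVal f) ∧
    (∀ (f : EuclideanSpace ℝ (Fin d) → ℝ) (x₀ : EuclideanSpace ℝ (Fin d)),
      GreedyFOM.IsInput (GreedyFOM.boundedSubgradientClass d M) R f x₀ →
      ∀ x g : ℕ → EuclideanSpace ℝ (Fin d), x 0 = x₀ →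
        (∀ i ≤ N, g i ∈ GreedyFOM.subdifferential f (x i)) →
        (∀ i, 1 ≤ i → i ≤ N →
          inner ℝ (g i) (x i - (((i : ℝ) / ((i : ℝ) + 1)) • x (i - 1)
            + (1 / ((i : ℝ) + 1)) • x₀
            - (1 / ((i : ℝ) + 1) * (R / (M * √((N : ℝ) + 1)))) •
                ∑ j ∈ Finset.range i, g j)) = 0) →
        f (x N) - GreedyFOM.optVal f ≤ M * R / √((N : ℝ) + 1)) := by
  refine ⟨?_, ?_, ?_⟩
  · rintro f x₀ hf _ ⟨x, g, hrun, rfl⟩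
    exact GreedyFOM.sub_optVal_le_of_scheme hM hR hf hrun.init hrun.subgrad
      fun i h1 hi => hrun.inner_sub_eq_zero _ h1 hi
  · intro hd ε hε
    exact GreedyFOM.exists_hard_input hM hR (by omega) hε
  · intro f x₀ hf x g hx hg hs
    exact GreedyFOM.sub_optVal_le_of_scheme hM hR hf hx hg hs
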